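/- Let $\Omega\subset\mathbb{R}^2$ be a bounded domain (nonempty, open, connected) with smooth boundary $\partial\Omega$, let $H\in\mathbb{R}$, and let $\varphi$ be a continuous function on $\partial\Omega$. Consider the Dirichlet problem for graphs of constant mean curvature $H$ in Euclidean space $\mathbb{E}^3$, $$(1+|Du|^2)\,\Delta u-\sum_{i,j=1}^{2}D_iu\,D_ju\,D_{ij}u=2H(1+|Du|^2)^{3/2}\ \text{ in }\Omega,\qquad u=\varphi\ \text{ on }\partial\Omega .$$ If this problem has a solution $u\in C^2(\Omega)\cap C^1(\overline\Omega)$ (that is, $u\in C^2(\Omega)\cap C^0(\overline\Omega)$ and the first derivatives of $u$ extend continuously to $\overline\Omega$), then $$|H|<\frac{\mathrm{length}(\partial\Omega)}{2\,\mathrm{area}(\Omega)} .$$ If it only has a solution $u\in C^2(\Omega)\cap C^0(\overline\Omega)$, then $$|H|\le\frac{\mathrm{length}(\partial\Omega)}{2\,\mathrm{area}(\Omega)} .$$ In both cases the bound does not depend on $\varphi$. Here $\mathrm{length}$ is one-dimensional Hausdorff measure. -/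

import Mathlib

open MeasureTheory
open scoped ContDiff

noncomputable section

namespace CMC

/-- The Euclidean plane. -/
abbrev Plane : Type := EuclideanSpace ℝ (Fin 2)

/-- A bounded domain (nonempty, open, connected) of the plane with smooth boundary: near every
boundary point, after a linear change of orthonormal coordinates, the domain is the open epigraph
of a smooth function of one variable. -/
structure IsBoundedSmoothDomain (Ω : Set Plane) : Prop where
  isOpen : IsOpen Ω
  isConnected : IsConnected Ω
  isBounded : Bornology.IsBounded Ω
  smooth_boundary : ∀ p ∈ frontier Ω, ∃ r > 0, ∃ e : Plane ≃ₗᵢ[ℝ] Plane, ∃ γ : ℝ → ℝ,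
    ContDiff ℝ ∞ γ ∧ ∀ x ∈ Metric.ball p r, x ∈ Ω ↔ γ ((e x) 0) < (e x) 1

/-- The partial derivative `D_i u`. -/
def partialD (i : Fin 2) (u : Plane → ℝ) (x : Plane) : ℝ :=
  fderiv ℝ u x (EuclideanSpace.single i 1)

/-- `|Du|²`. -/
def gradSq (u : Plane → ℝ) (x : Plane) : ℝ := ∑ i, partialD i u x ^ 2

/-- The Laplacian `Δu`. -/
def lap (u : Plane → ℝ) (x : Plane) : ℝ := ∑ i, partialD i (partialD i u) x

/-- `u ∈ C²(Ω) ∩ C⁰(closure Ω)` solves the Dirichlet problem in `𝔼³` for the equation of constant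
mean curvature `H` on `Ω`, with boundary values `φ`. -/
structure IsDirichletSolution (Ω : Set Plane) (H : ℝ) (φ u : Plane → ℝ) : Prop where
  contDiffOn : ContDiffOn ℝ 2 u Ω
  continuousOn : ContinuousOn u (closure Ω)
  equation : ∀ x ∈ Ω,
    (1 + gradSq u x) * lap u x
        - ∑ i, ∑ j, partialD i u x * partialD j u x * partialD i (partialD j u) x
      = 2 * H * (1 + gradSq u x) ^ (3 / 2 : ℝ)
  boundary : ∀ x ∈ frontier Ω, u x = φ x

/-- The first derivatives of `u` in `Ω` extend continuously to the closure of `Ω`; together with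
`u ∈ C²(Ω) ∩ C⁰(closure Ω)` this says `u ∈ C²(Ω) ∩ C¹(closure Ω)`. -/
def GradExtends (Ω : Set Plane) (u : Plane → ℝ) : Prop :=
  ∀ i, ∃ g : Plane → ℝ, ContinuousOn g (closure Ω) ∧ ∀ x ∈ Ω, g x = partialD i u x

/-- The area of a plane region. -/
def area (Ω : Set Plane) : ℝ := (volume Ω).toReal

/-- The length of a plane curve or finite union of curves: its one-dimensional Hausdorff
measure. -/
def length (Γ : Set Plane) : ℝ := (Measure.hausdorffMeasure 1 Γ).toReal

end CMC

end

/-! The equation says that the horizontal part `X = Du / √(1 + |Du|²)` of the unit normal has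
divergence `2H`, and `|X| < 1`. Integrating over `Ω` gives `2|H| area Ω ≤ sup |X| · length ∂Ω`,
hence the weak bound with `sup |X| ≤ 1`. If the gradient extends continuously to the compact closure
then it is bounded, so `sup |X| < 1`, and the inequality is strict because `∂Ω` has positive length.

Since `X` need have no trace on `∂Ω`, the divergence theorem is replaced by an inequality
(`abs_mul_area_le`) that uses only `|X| ≤ c`. Tested against functions supported in `Ω`, the
divergence equation gives zero (`weakFlux_eq_zero`). A test function `ψ` living near a boundary
point is first multiplied by a cutoff that vanishes in a layer of thickness `δ` along the boundary.
The error is at most `c ∫ ψ |Dη|` with `η` the cutoff, and a bound for this integral tends to `c`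
times the integral of `ψ` against arc length (`exists_nhds_weakFlux_le`). A partition of unity adds
up the local bounds (`enorm_integral_const_le`).

Arc length enters as Hausdorff measure, and only the inequality "arc length ≤ `(1 + ε)` Hausdorff
measure" on small arcs is needed; `ε` tends to zero at the end. -/

namespace CMC
open Set Filter Topology
open scoped ENNReal Manifold

/-! ### Arc length of a graph compared with Hausdorff measure -/

/-- The point on the graph of `γ` shifted up by `t`, in the coordinates given by `e`. -/
noncomputable def graphPoint (e : Plane ≃ₗᵢ[ℝ] Plane) (γ : ℝ → ℝ) (t s : ℝ) : Plane :=
  e.symm (!₂[s, γ s + t])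

/-- The density of arc length on the graph of `γ`. -/
noncomputable def arcDensity (γ : ℝ → ℝ) (s : ℝ) : ℝ := √(1 + deriv γ s ^ 2)

lemma arcDensity_pos (γ : ℝ → ℝ) (s : ℝ) : 0 < arcDensity γ s :=
  Real.sqrt_pos.2 (by positivity)

lemma continuous_arcDensity {γ : ℝ → ℝ} (hγ : ContDiff ℝ ∞ γ) : Continuous (arcDensity γ) := by
  have := hγ.continuous_deriv (by simp)
  unfold arcDensity
  fun_prop

lemma continuous_graphPoint {γ : ℝ → ℝ} (e : Plane ≃ₗᵢ[ℝ] Plane) (hγ : Continuous γ) :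
    Continuous fun p : ℝ × ℝ => graphPoint e γ p.1 p.2 := by
  unfold graphPoint
  refine e.symm.continuous.comp ((PiLp.continuous_toLp 2 _).comp (continuous_pi fun i => ?_))
  fin_cases i
  · exact continuous_snd
  · exact (hγ.comp continuous_snd).add continuous_fst

@[simp] lemma apply_graphPoint (e : Plane ≃ₗᵢ[ℝ] Plane) (γ : ℝ → ℝ) (t s : ℝ) :
    e (graphPoint e γ t s) = !₂[s, γ s + t] := by simp [graphPoint]

/-- Projecting to the line of direction `(1, m)` is a contraction. -/
lemma lipschitzWith_slope_projection (e : Plane ≃ₗᵢ[ℝ] Plane) (m : ℝ) :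
    LipschitzWith 1 fun x : Plane => ((e x) 0 + m * (e x) 1) / √(1 + m ^ 2) := by
  refine LipschitzWith.of_dist_le_mul fun x y => ?_
  have hw : 0 < √(1 + m ^ 2) := Real.sqrt_pos.2 (by positivity)
  rw [NNReal.coe_one, one_mul, ← e.dist_map x y, EuclideanSpace.dist_eq, Real.dist_eq,
    ← sub_div, abs_div, abs_of_pos hw, div_le_iff₀ hw, ← Real.sqrt_mul (by positivity)]
  refine Real.abs_le_sqrt ?_
  simp only [Fin.sum_univ_two, Real.dist_eq, sq_abs]
  nlinarith [sq_nonneg (((e x) 0 - (e y) 0) * m - ((e x) 1 - (e y) 1))]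

/-- Orthogonal projection to the tangent line at `s₀` does not increase Hausdorff measure, and near
`s₀` it shrinks arc length by a factor of at most `1 + ε`. On the line, Hausdorff measure is
Lebesgue measure, where the change of variables formula applies. -/
lemma exists_nhds_lintegral_arcDensity_le (e : Plane ≃ₗᵢ[ℝ] Plane) {γ : ℝ → ℝ}
    (hγ : ContDiff ℝ ∞ γ) (s₀ : ℝ) {ε : ℝ} (hε : 0 < ε) :
    ∃ ρ > 0, ∀ B ⊆ Metric.ball s₀ ρ, MeasurableSet B →
      ∫⁻ s in B, ENNReal.ofReal (arcDensity γ s) ≤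
        ENNReal.ofReal (1 + ε) * Measure.hausdorffMeasure 1 (graphPoint e γ 0 '' B) := by
  set m := deriv γ s₀
  set w := √(1 + m ^ 2) with hwdef
  have hw : 0 < w := Real.sqrt_pos.2 (by positivity)
  have hw2 : w ^ 2 = 1 + m ^ 2 := Real.sq_sqrt (by positivity)
  have hd : Continuous (deriv γ) := hγ.continuous_deriv (by simp)
  -- At `s₀` the projected speed `(1 + m * m) / w` equals the full speed `w`, so continuity gives
  -- the strict inequality nearby.
  have hlim : ∀ᶠ s in 𝓝 s₀, arcDensity γ s < (1 + ε) * ((1 + m * deriv γ s) / w) := by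
    refine (continuous_arcDensity hγ).continuousAt.eventually_lt
      (g := fun s => (1 + ε) * ((1 + m * deriv γ s) / w)) (by fun_prop) ?_
    have : (1 + m * m) / w = w := by field_simp; linarith
    change w < (1 + ε) * ((1 + m * m) / w)
    rw [this]; nlinarith
  obtain ⟨ρ, hρ, hball⟩ := Metric.eventually_nhds_iff_ball.1 hlim
  refine ⟨ρ, hρ, fun B hB hBm => ?_⟩
  set f : ℝ → ℝ := fun s => (s + m * γ s) / w
  have hf : ∀ s, HasDerivAt f ((1 + m * deriv γ s) / w) s := fun s =>
    ((hasDerivAt_id s).add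
      (((hγ.differentiable (by simp)) s).hasDerivAt.const_mul m)).div_const w
  have hpos : ∀ s ∈ Metric.ball s₀ ρ, 0 < (1 + m * deriv γ s) / w := fun s hs => by
    have h := (arcDensity_pos γ s).trans (hball s hs)
    exact (pos_iff_pos_of_mul_pos h).1 (by linarith)
  have hmono : MonotoneOn f (Metric.ball s₀ ρ) :=
    monotoneOn_of_deriv_nonneg (convex_ball _ _) (fun s _ => (hf s).continuousAt.continuousWithinAt)
      (fun s _ => (hf s).differentiableAt.differentiableWithinAt) (fun s hs => by
        rw [(hf s).deriv]; exact (hpos s (interior_subset hs)).le)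
  calc ∫⁻ s in B, ENNReal.ofReal (arcDensity γ s)
      ≤ ∫⁻ s in B, ENNReal.ofReal (1 + ε) * ENNReal.ofReal ((1 + m * deriv γ s) / w) := by
        refine setLIntegral_mono' hBm fun s hs => ?_
        rw [← ENNReal.ofReal_mul (by linarith)]
        exact ENNReal.ofReal_le_ofReal (hball s (hB hs)).le
    _ = ENNReal.ofReal (1 + ε) * volume (f '' B) := by
        rw [lintegral_const_mul' _ _ ENNReal.ofReal_ne_top,
          lintegral_deriv_eq_volume_image_of_monotoneOn hBm
            (fun s _ => (hf s).hasDerivWithinAt) (hmono.mono hB)]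
    _ ≤ _ := by
        gcongr
        have himg : f '' B = (fun x : Plane => ((e x) 0 + m * (e x) 1) / √(1 + m ^ 2)) ''
            (graphPoint e γ 0 '' B) := by
          rw [image_image]; simp [f, w]
        rw [himg, ← hausdorffMeasure_real]
        simpa using (lipschitzWith_slope_projection e m).hausdorffMeasure_image_le zero_le_one
          (graphPoint e γ 0 '' B)

lemma measurableEmbedding_graphPoint (e : Plane ≃ₗᵢ[ℝ] Plane) {γ : ℝ → ℝ} (hγ : Continuous γ) :
    MeasurableEmbedding (graphPoint e γ 0) := by
  refine Continuous.measurableEmbedding ?_ fun s t h => ?_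
  · exact (continuous_graphPoint e hγ).comp (Continuous.prodMk_right 0)
  · have := congrArg (fun x => (e x) 0) h
    simpa using this

/-- The bound on sets is an inequality between two measures on the line, arc length on `J` and the
pulled-back Hausdorff measure, so it passes to integrals of nonnegative functions. -/
lemma lintegral_arcDensity_le (e : Plane ≃ₗᵢ[ℝ] Plane) {γ : ℝ → ℝ} (hγ : Continuous γ)
    {C : ℝ≥0∞} {J : Set ℝ} (hJ : MeasurableSet J)
    (hlen : ∀ B ⊆ J, MeasurableSet B → ∫⁻ s in B, ENNReal.ofReal (arcDensity γ s) ≤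
        C * Measure.hausdorffMeasure 1 (graphPoint e γ 0 '' B))
    {ψ : Plane → ℝ≥0∞} (hψ : Measurable ψ) {S : Set Plane} (hS : MeasurableSet S)
    (hsupp : ∀ s, ψ (graphPoint e γ 0 s) ≠ 0 → s ∈ J ∧ graphPoint e γ 0 s ∈ S) :
    ∫⁻ s, ENNReal.ofReal (arcDensity γ s) * ψ (graphPoint e γ 0 s) ≤
      C * ∫⁻ x in S, ψ x ∂(Measure.hausdorffMeasure 1) := by
  have hG := measurableEmbedding_graphPoint e hγ
  have hw : Measurable fun s => ENNReal.ofReal (arcDensity γ s) := by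
    unfold arcDensity; fun_prop
  have hle : (volume.withDensity fun s => ENNReal.ofReal (arcDensity γ s)).restrict J ≤
      C • Measure.comap (graphPoint e γ 0) (Measure.hausdorffMeasure 1) := by
    refine Measure.le_iff.2 fun B hB => ?_
    rw [Measure.restrict_apply hB, withDensity_apply _ (hB.inter hJ), Measure.smul_apply,
      hG.comap_apply, smul_eq_mul]
    refine (hlen _ inter_subset_right (hB.inter hJ)).trans ?_
    gcongr
    exact inter_subset_left
  have hmeas : Measurable fun s => ψ (graphPoint e γ 0 s) := hψ.comp hG.measurable
  calc ∫⁻ s, ENNReal.ofReal (arcDensity γ s) * ψ (graphPoint e γ 0 s)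
      = ∫⁻ s in J, ψ (graphPoint e γ 0 s)
          ∂(volume.withDensity fun s => ENNReal.ofReal (arcDensity γ s)) := by
        rw [setLIntegral_eq_of_support_subset, lintegral_withDensity_eq_lintegral_mul _ hw hmeas]
        · rfl
        · exact fun s hs => (hsupp s hs).1
    _ ≤ C * ∫⁻ s, ψ (graphPoint e γ 0 s)
          ∂(Measure.comap (graphPoint e γ 0) (Measure.hausdorffMeasure 1)) := by
        rw [← smul_eq_mul, ← lintegral_smul_measure]
        exact lintegral_mono' hle le_rfl
    _ = C * ∫⁻ x in range (graphPoint e γ 0), ψ x ∂(Measure.hausdorffMeasure 1) := by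
        rw [← hG.lintegral_map, hG.map_comap]
    _ ≤ _ := by
        gcongr C * ?_
        rw [← lintegral_indicator hG.measurableSet_range, ← lintegral_indicator hS]
        refine lintegral_mono fun x => ?_
        by_cases hx : x ∈ range (graphPoint e γ 0)
        · obtain ⟨s, rfl⟩ := hx
          by_cases h0 : ψ (graphPoint e γ 0 s) = 0
          · simp [indicator, h0]
          · rw [indicator_of_mem (mem_range_self s), indicator_of_mem (hsupp s h0).2]
        · simp [indicator_of_notMem hx]

/-! ### The divergence equation in weak form -/

/-- The pairing of a test function `ζ` with the distribution `K - div X` on `Ω`. -/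
noncomputable def weakFlux (Ω : Set Plane) (K : ℝ) (X : Plane → Plane) (ζ : Plane → ℝ) : ℝ :=
  ∫ x in Ω, (K * ζ x + fderiv ℝ ζ x (X x))

lemma fderiv_apply_eq_sum (ζ : Plane → ℝ) (x v : Plane) :
    fderiv ℝ ζ x v = ∑ i, v i * partialD i ζ x := by
  have hv : v = ∑ i, v i • EuclideanSpace.single i (1 : ℝ) := by
    ext j
    fin_cases j <;> simp
  conv_lhs => rw [hv]
  simp [partialD]

lemma continuous_partialD {f : Plane → ℝ} (hf : ContDiff ℝ 1 f) (i : Fin 2) :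
    Continuous (partialD i f) :=
  (hf.continuous_fderiv (by simp)).clm_apply continuous_const

lemma hasCompactSupport_partialD {f : Plane → ℝ} (hc : HasCompactSupport f) (i : Fin 2) :
    HasCompactSupport (partialD i f) :=
  hc.fderiv_apply ℝ _

lemma integral_partialD_eq_zero {f : Plane → ℝ} (hf : ContDiff ℝ 1 f) (hc : HasCompactSupport f)
    (i : Fin 2) : ∫ x, partialD i f x = 0 := by
  -- Integration by parts against the constant function `1`.
  have h := integral_mul_fderiv_eq_neg_fderiv_mul_of_integrable (μ := (volume : Measure Plane))
    (f := fun _ => (1 : ℝ)) (g := f) (v := EuclideanSpace.single i 1) (by simp)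
    (by simpa [partialD] using! (continuous_partialD hf i).integrable_of_hasCompactSupport
          (μ := volume) (hasCompactSupport_partialD hc i))
    (by simpa using hf.continuous.integrable_of_hasCompactSupport (μ := volume) hc)
    (by fun_prop) (fun x _ => hf.differentiable (by simp) x)
  simpa [partialD] using h

lemma contDiff_mul_of_tsupport_subset {Ω : Set Plane} (hΩ : IsOpen Ω) {ζ f : Plane → ℝ}
    (hζ : ContDiff ℝ 1 ζ) (hsub : tsupport ζ ⊆ Ω) (hf : ContDiffOn ℝ 1 f Ω) :
    ContDiff ℝ 1 fun x => ζ x * f x := by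
  refine contDiff_iff_contDiffAt.2 fun x => ?_
  by_cases hx : x ∈ tsupport ζ
  · exact hζ.contDiffAt.mul (hf.contDiffAt (hΩ.mem_nhds (hsub hx)))
  · have : (fun x => ζ x * f x) =ᶠ[𝓝 x] fun _ => 0 := by
      filter_upwards [notMem_tsupport_iff_eventuallyEq.1 hx] with y hy
      simp [hy]
    exact contDiffAt_const.congr_of_eventuallyEq this

/-- On `Ω` the integrand is the divergence of `ζ X`, which extended by zero is a compactly supported
`C¹` field on the plane. -/
lemma weakFlux_eq_zero {Ω : Set Plane} (hΩ : IsOpen Ω) {K : ℝ} {X : Plane → Plane}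
    (hX : ∀ i, ContDiffOn ℝ 1 (fun x => X x i) Ω)
    (hdiv : ∀ x ∈ Ω, ∑ i, partialD i (fun y => X y i) x = K)
    {ζ : Plane → ℝ} (hζ : ContDiff ℝ ∞ ζ) (hc : HasCompactSupport ζ) (hsub : tsupport ζ ⊆ Ω) :
    weakFlux Ω K X ζ = 0 := by
  have hζ1 : ContDiff ℝ 1 ζ := hζ.of_le (by simp)
  have hF : ∀ i, ContDiff ℝ 1 fun x => ζ x * X x i := fun i =>
    contDiff_mul_of_tsupport_subset hΩ hζ1 hsub (hX i)
  have hFc : ∀ i, HasCompactSupport fun x => ζ x * X x i := fun i => hc.mul_right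
  have hin : ∀ x ∈ Ω, K * ζ x + fderiv ℝ ζ x (X x) =
      ∑ i, partialD i (fun x => ζ x * X x i) x := by
    intro x hx
    rw [fderiv_apply_eq_sum, ← hdiv x hx, Finset.sum_mul, ← Finset.sum_add_distrib]
    refine Finset.sum_congr rfl fun i _ => ?_
    have hXd : DifferentiableAt ℝ (fun x => X x i) x :=
      ((hX i).contDiffAt (hΩ.mem_nhds hx)).differentiableAt (by simp)
    have hζd : DifferentiableAt ℝ ζ x := hζ1.differentiable (by simp) x
    unfold partialD
    rw [fderiv_fun_mul hζd hXd]
    simp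
    ring
  have hout : ∀ x ∉ Ω, ∑ i, partialD i (fun x => ζ x * X x i) x = 0 := by
    intro x hx
    refine Finset.sum_eq_zero fun i _ => ?_
    have h0 : (fun x => ζ x * X x i) =ᶠ[𝓝 x] fun _ => 0 := by
      filter_upwards [notMem_tsupport_iff_eventuallyEq.1 fun h => hx (hsub h)] with y hy
      simp [hy]
    simp [partialD, h0.fderiv_eq]
  rw [weakFlux, setIntegral_congr_fun hΩ.measurableSet hin,
    setIntegral_eq_integral_of_forall_compl_eq_zero hout,
    integral_finsetSum _ fun i _ => (continuous_partialD (hF i) i).integrable_of_hasCompactSupport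
      (hasCompactSupport_partialD (hFc i) i)]
  exact Finset.sum_eq_zero fun i _ => integral_partialD_eq_zero (hF i) (hFc i) i

/-! ### Integrals over thin layers above a graph -/

/-- A smooth monotone function equal to `0` on `(-∞, 1]` and to `1` on `[2, ∞)`. -/
noncomputable def ramp (t : ℝ) : ℝ := Real.smoothTransition (t - 1)

lemma contDiff_ramp : ContDiff ℝ ∞ ramp :=
  Real.smoothTransition.contDiff.comp (contDiff_id.sub contDiff_const)

lemma monotone_ramp : Monotone ramp := fun _ _ h =>
  Real.smoothTransition.monotone (by linarith)

lemma ramp_of_le {t : ℝ} (h : t ≤ 1) : ramp t = 0 :=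
  Real.smoothTransition.zero_of_nonpos (by linarith)

lemma ramp_of_ge {t : ℝ} (h : 2 ≤ t) : ramp t = 1 :=
  Real.smoothTransition.one_of_one_le (by linarith)

lemma continuous_deriv_ramp : Continuous (deriv ramp) := contDiff_ramp.continuous_deriv (by simp)

lemma deriv_ramp_nonneg (t : ℝ) : 0 ≤ deriv ramp t := monotone_ramp.deriv_nonneg

lemma deriv_ramp_of_notMem {t : ℝ} (h : t ∉ Icc (1 : ℝ) 2) : deriv ramp t = 0 := by
  rw [mem_Icc, not_and_or, not_le, not_le] at h
  rcases h with h | h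
  · have : ramp =ᶠ[𝓝 t] fun _ => 0 := by
      filter_upwards [gt_mem_nhds h] with s hs using ramp_of_le hs.le
    simp [this.deriv_eq]
  · have : ramp =ᶠ[𝓝 t] fun _ => 1 := by
      filter_upwards [lt_mem_nhds h] with s hs using ramp_of_ge hs.le
    simp [this.deriv_eq]

lemma lintegral_deriv_ramp : ∫⁻ t, ENNReal.ofReal (deriv ramp t) = 1 := by
  have hint : ∫ t in (1 : ℝ)..2, deriv ramp t = 1 := by
    rw [intervalIntegral.integral_deriv_eq_sub
      (fun t _ => contDiff_ramp.differentiable (by simp) t)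
      (continuous_deriv_ramp.intervalIntegrable _ _), ramp_of_ge le_rfl, ramp_of_le le_rfl, sub_zero]
  have hsupp : (Function.support fun t => ENNReal.ofReal (deriv ramp t)) ⊆ Icc 1 2 := by
    intro t ht
    by_contra h
    exact ht (by simp [deriv_ramp_of_notMem h])
  rw [← setLIntegral_eq_of_support_subset hsupp, ← ofReal_integral_eq_lintegral_ofReal
    (continuous_deriv_ramp.continuousOn.integrableOn_compact isCompact_Icc)
    (ae_of_all _ deriv_ramp_nonneg), integral_Icc_eq_integral_Ioc,
    ← intervalIntegral.integral_of_le one_le_two, hint, ENNReal.ofReal_one]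

/-- The signed height above the graph of `γ`. -/
noncomputable def height (e : Plane ≃ₗᵢ[ℝ] Plane) (γ : ℝ → ℝ) (x : Plane) : ℝ :=
  (e x) 1 - γ ((e x) 0)

@[simp] lemma height_graphPoint (e : Plane ≃ₗᵢ[ℝ] Plane) (γ : ℝ → ℝ) (t s : ℝ) :
    height e γ (graphPoint e γ t s) = t := by simp [height]

lemma contDiff_coord (e : Plane ≃ₗᵢ[ℝ] Plane) (i : Fin 2) :
    ContDiff ℝ ∞ fun x => (e x) i :=
  ((EuclideanSpace.proj (𝕜 := ℝ) i).contDiff).comp e.contDiff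

lemma contDiff_height (e : Plane ≃ₗᵢ[ℝ] Plane) {γ : ℝ → ℝ} (hγ : ContDiff ℝ ∞ γ) :
    ContDiff ℝ ∞ (height e γ) :=
  (contDiff_coord e 1).sub (hγ.comp (contDiff_coord e 0))

lemma fderiv_height_apply (e : Plane ≃ₗᵢ[ℝ] Plane) {γ : ℝ → ℝ} (hγ : ContDiff ℝ ∞ γ)
    (x v : Plane) :
    fderiv ℝ (height e γ) x v = (e v) 1 - deriv γ ((e x) 0) * (e v) 0 := by
  have hc : ∀ i, HasFDerivAt (fun x => (e x) i)
      ((EuclideanSpace.proj (𝕜 := ℝ) i).comp (e.toContinuousLinearEquiv : Plane →L[ℝ] Plane)) x :=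
    fun i => ((EuclideanSpace.proj (𝕜 := ℝ) i).comp
      (e.toContinuousLinearEquiv : Plane →L[ℝ] Plane)).hasFDerivAt
  have hg : HasDerivAt γ (deriv γ ((e x) 0)) ((e x) 0) :=
    (hγ.differentiable (by simp) _).hasDerivAt
  have h := (hc 1).sub (hg.comp_hasFDerivAt x (hc 0))
  have h' : HasFDerivAt (height e γ) _ x := h
  rw [h'.fderiv]
  simp

/-- Cauchy–Schwarz: the gradient of the height has length `arcDensity γ`. This factor turns `ds`
into arc length in the layer integrals. -/
lemma abs_fderiv_height_le (e : Plane ≃ₗᵢ[ℝ] Plane) {γ : ℝ → ℝ} (hγ : ContDiff ℝ ∞ γ)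
    (x v : Plane) :
    |fderiv ℝ (height e γ) x v| ≤ arcDensity γ ((e x) 0) * ‖v‖ := by
  rw [fderiv_height_apply e hγ, ← e.norm_map v, EuclideanSpace.norm_eq, arcDensity,
    ← Real.sqrt_mul (by positivity)]
  refine Real.abs_le_sqrt ?_
  simp only [Fin.sum_univ_two, Real.norm_eq_abs, sq_abs]
  nlinarith [sq_nonneg ((e v) 1 * deriv γ ((e x) 0) + (e v) 0)]

/-- An isometry followed by Fubini; on each vertical line the shift by `γ s` preserves Lebesgue
measure. -/
lemma lintegral_eq_lintegral_graphPoint (e : Plane ≃ₗᵢ[ℝ] Plane) {γ : ℝ → ℝ}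
    {F : Plane → ℝ≥0∞} (hF : Measurable F) :
    ∫⁻ x, F x = ∫⁻ s, ∫⁻ t, F (graphPoint e γ t s) := by
  have hmp : MeasurePreserving (fun p : ℝ × ℝ => e.symm (!₂[p.1, p.2])) :=
    e.symm.measurePreserving.comp ((PiLp.volume_preserving_toLp (Fin 2)).comp
      (volume_preserving_finTwoArrow ℝ).symm)
  rw [← hmp.lintegral_comp hF, Measure.volume_eq_prod, lintegral_prod
    (fun p : ℝ × ℝ => F (e.symm (!₂[p.1, p.2]))) (hF.comp hmp.measurable).aemeasurable]
  refine lintegral_congr fun s => ?_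
  exact (lintegral_add_left_eq_self (fun t => F (e.symm (!₂[s, t]))) (γ s)).symm

lemma lintegral_scaled_layer (e : Plane ≃ₗᵢ[ℝ] Plane) {γ : ℝ → ℝ} (hγ : ContDiff ℝ ∞ γ)
    {ψ : Plane → ℝ} (hψ : Continuous ψ) {δ : ℝ} (hδ : 0 < δ) :
    ∫⁻ x, ENNReal.ofReal (arcDensity γ ((e x) 0)) *
        (ENNReal.ofReal (δ⁻¹ * deriv ramp (height e γ x / δ)) * ENNReal.ofReal (ψ x)) =
      ∫⁻ p : ℝ × ℝ, ENNReal.ofReal (arcDensity γ p.1) *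
        (ENNReal.ofReal (deriv ramp p.2) * ENNReal.ofReal (ψ (graphPoint e γ (δ * p.2) p.1))) := by
  have hw := continuous_arcDensity hγ
  have h0 := (contDiff_coord e 0).continuous
  have hh := (contDiff_height e hγ).continuous
  have hr := continuous_deriv_ramp
  have hG := continuous_graphPoint e hγ.continuous
  have hGm : Continuous fun p : ℝ × ℝ => graphPoint e γ (δ * p.2) p.1 :=
    hG.comp (by fun_prop : Continuous fun p : ℝ × ℝ => (δ * p.2, p.1))
  rw [lintegral_eq_lintegral_graphPoint e (γ := γ)]
  · rw [Measure.volume_eq_prod, lintegral_prod]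
    · refine lintegral_congr fun s => ?_
      simp only [apply_graphPoint, height_graphPoint]
      have hGs : Continuous fun t => graphPoint e γ t s :=
        hG.comp (by fun_prop : Continuous fun t : ℝ => (t, s))
      -- Substituting `δ * t` for the height `t` produces a factor `δ`, which cancels the `δ⁻¹`.
      have hmap := Real.smul_map_volume_mul_left hδ.ne'
      conv_lhs => rw [← hmap]
      rw [lintegral_smul_measure, lintegral_map _ (by fun_prop), smul_eq_mul,
        ← lintegral_const_mul' _ _ ENNReal.ofReal_ne_top]
      · refine lintegral_congr fun t => ?_
        have h1 : δ * t / δ = t := by field_simp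
        have h2 : ENNReal.ofReal δ * ENNReal.ofReal δ⁻¹ = 1 := by
          rw [← ENNReal.ofReal_mul hδ.le, mul_inv_cancel₀ hδ.ne', ENNReal.ofReal_one]
        simp only [Matrix.cons_val_zero, h1, abs_of_pos hδ]
        rw [ENNReal.ofReal_mul (inv_nonneg.2 hδ.le)]
        calc _ = (ENNReal.ofReal δ * ENNReal.ofReal δ⁻¹) * (ENNReal.ofReal (arcDensity γ s) *
              (ENNReal.ofReal (deriv ramp t) *
                ENNReal.ofReal (ψ (graphPoint e γ (δ * t) s)))) := by ring
          _ = _ := by rw [h2, one_mul]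
      · fun_prop
    · fun_prop
  · fun_prop

/-- Dominated convergence in the rescaled height. The profile `deriv ramp` has integral one, so the
layer concentrates to arc length on the graph. -/
lemma tendsto_lintegral_layer (e : Plane ≃ₗᵢ[ℝ] Plane) {γ : ℝ → ℝ} (hγ : ContDiff ℝ ∞ γ)
    {ψ : Plane → ℝ} (hψ : Continuous ψ) (hc : HasCompactSupport ψ)
    {δ : ℕ → ℝ} (hδ : Tendsto δ atTop (𝓝 0)) :
    Tendsto (fun n => ∫⁻ p : ℝ × ℝ, ENNReal.ofReal (arcDensity γ p.1) *
        (ENNReal.ofReal (deriv ramp p.2) *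
          ENNReal.ofReal (ψ (graphPoint e γ (δ n * p.2) p.1)))) atTop
      (𝓝 (∫⁻ s, ENNReal.ofReal (arcDensity γ s) * ENNReal.ofReal (ψ (graphPoint e γ 0 s)))) := by
  have hw := continuous_arcDensity hγ
  have hr := continuous_deriv_ramp
  have hG := continuous_graphPoint e hγ.continuous
  have hGm : ∀ d : ℝ, Continuous fun p : ℝ × ℝ => graphPoint e γ (d * p.2) p.1 := fun d =>
    hG.comp (by fun_prop : Continuous fun p : ℝ × ℝ => (d * p.2, p.1))
  have hlim : ∫⁻ s, ENNReal.ofReal (arcDensity γ s) * ENNReal.ofReal (ψ (graphPoint e γ 0 s)) =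
      ∫⁻ p : ℝ × ℝ, ENNReal.ofReal (arcDensity γ p.1) *
        (ENNReal.ofReal (deriv ramp p.2) * ENNReal.ofReal (ψ (graphPoint e γ (0 * p.2) p.1))) := by
    rw [Measure.volume_eq_prod, lintegral_prod _ (by have := hGm 0; fun_prop)]
    refine lintegral_congr fun s => ?_
    simp only [zero_mul]
    rw [lintegral_const_mul' _ _ ENNReal.ofReal_ne_top,
      lintegral_mul_const' _ _ ENNReal.ofReal_ne_top, lintegral_deriv_ramp, one_mul]
  rw [hlim]
  obtain ⟨M, hM⟩ := hψ.bounded_above_of_compact_support hc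
  obtain ⟨R, hR⟩ := hc.isCompact.isBounded.exists_norm_le
  have hR' : ∀ t s, ψ (graphPoint e γ t s) ≠ 0 → s ∈ Icc (-R) R := by
    intro t s h
    have h1 := hR _ (subset_tsupport _ h)
    have h2 := PiLp.norm_apply_le (e (graphPoint e γ t s)) 0
    rw [e.norm_map] at h2
    rw [mem_Icc, ← abs_le]
    simpa using h2.trans h1
  set D : ℝ × ℝ → ℝ≥0∞ := (Icc (-R) R ×ˢ Icc (1 : ℝ) 2).indicator fun p =>
    ENNReal.ofReal (arcDensity γ p.1) * (ENNReal.ofReal (deriv ramp p.2) * ENNReal.ofReal M)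
  refine tendsto_lintegral_of_dominated_convergence D (fun n => by have := hGm (δ n); fun_prop)
    (fun n => ae_of_all _ fun p => ?_) ?_ (ae_of_all _ fun p => ?_)
  · by_cases hp : p ∈ Icc (-R) R ×ˢ Icc (1 : ℝ) 2
    · simp only [D, indicator_of_mem hp]
      gcongr
      exact (le_abs_self _).trans (hM _)
    · rw [mem_prod, not_and_or] at hp
      rcases hp with hp | hp
      · have : ψ (graphPoint e γ (δ n * p.2) p.1) = 0 := by
          by_contra h
          exact hp (hR' _ _ h)
        simp [this]
      · simp [deriv_ramp_of_notMem hp]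
  · have hK : IsCompact (Icc (-R) R ×ˢ Icc (1 : ℝ) 2) := isCompact_Icc.prod isCompact_Icc
    rw [lintegral_indicator hK.measurableSet]
    have hcont : Continuous fun p : ℝ × ℝ => arcDensity γ p.1 * (deriv ramp p.2 * M) := by fun_prop
    have hi := (hcont.continuousOn.integrableOn_compact (μ := volume) hK).lintegral_lt_top
    refine (lt_of_eq_of_lt ?_ hi).ne
    refine lintegral_congr fun p => ?_
    rw [ENNReal.ofReal_mul (arcDensity_pos _ _).le, ENNReal.ofReal_mul (deriv_ramp_nonneg _)]
  · have hcont : Continuous fun d : ℝ => graphPoint e γ (d * p.2) p.1 :=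
      hG.comp (by fun_prop : Continuous fun d : ℝ => (d * p.2, p.1))
    refine ENNReal.Tendsto.const_mul (ENNReal.Tendsto.const_mul ?_
      (Or.inr ENNReal.ofReal_ne_top)) (Or.inr ENNReal.ofReal_ne_top)
    exact ENNReal.tendsto_ofReal (((hψ.comp hcont).tendsto 0).comp hδ)

lemma integrableOn_weakFlux {Ω : Set Plane} (hΩ : IsOpen Ω) (hb : Bornology.IsBounded Ω) (K : ℝ)
    {X : Plane → Plane} (hX : ContinuousOn X Ω) {c : ℝ} (hXc : ∀ x ∈ Ω, ‖X x‖ ≤ c)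
    {ζ : Plane → ℝ} (hζ : ContDiff ℝ ∞ ζ) (hc : HasCompactSupport ζ) :
    IntegrableOn (fun x => K * ζ x + fderiv ℝ ζ x (X x)) Ω := by
  have hfin : volume Ω < ⊤ := hb.measure_lt_top
  have hdc : Continuous (fderiv ℝ ζ) := hζ.continuous_fderiv (by simp)
  obtain ⟨M, hM⟩ := hζ.continuous.bounded_above_of_compact_support hc
  obtain ⟨N, hN⟩ := hdc.bounded_above_of_compact_support (hc.fderiv ℝ)
  have hcont : ContinuousOn (fun x => K * ζ x + fderiv ℝ ζ x (X x)) Ω :=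
    (continuousOn_const.mul hζ.continuous.continuousOn).add (hdc.continuousOn.clm_apply hX)
  refine IntegrableOn.of_bound hfin (hcont.aestronglyMeasurable hΩ.measurableSet)
    (‖K‖ * M + N * c) ?_
  filter_upwards [ae_restrict_mem hΩ.measurableSet] with x hx
  refine (norm_add_le _ _).trans (add_le_add ?_ ?_)
  · rw [norm_mul]
    gcongr
    exact hM x
  · refine (ContinuousLinearMap.le_opNorm _ _).trans ?_
    have := (norm_nonneg _).trans (hN x)
    gcongr
    exacts [hN x, hXc x hx]

/-! ### Cutoffs at the boundary and the local flux bound -/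

lemma graphPoint_mem_frontier {Ω : Set Plane} (hΩ : IsOpen Ω) {p : Plane} {r : ℝ}
    (e : Plane ≃ₗᵢ[ℝ] Plane) {γ : ℝ → ℝ} (hγ : Continuous γ)
    (hloc : ∀ x ∈ Metric.ball p r, x ∈ Ω ↔ γ ((e x) 0) < (e x) 1) {s : ℝ}
    (hs : graphPoint e γ 0 s ∈ Metric.ball p r) : graphPoint e γ 0 s ∈ frontier Ω := by
  have hcont : Continuous fun t => graphPoint e γ t s :=
    (continuous_graphPoint e hγ).comp (by fun_prop : Continuous fun t : ℝ => (t, s))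
  rw [hΩ.frontier_eq]
  refine ⟨?_, fun h => by simpa using (hloc _ hs).1 h⟩
  have hlim : Tendsto (fun t => graphPoint e γ t s) (𝓝[>] 0) (𝓝 (graphPoint e γ 0 s)) :=
    (hcont.tendsto 0).mono_left nhdsWithin_le_nhds
  refine mem_closure_of_tendsto hlim ?_
  filter_upwards [hlim.eventually (Metric.isOpen_ball.mem_nhds hs), self_mem_nhdsWithin]
    with t ht ht0
  exact (hloc _ ht).2 (by simpa using ht0)

/-- The cutoff function vanishing below height `δ` above the graph of `γ`. -/
noncomputable def layerCutoff (e : Plane ≃ₗᵢ[ℝ] Plane) (γ : ℝ → ℝ) (δ : ℝ) (x : Plane) : ℝ :=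
  ramp (height e γ x / δ)

lemma contDiff_layerCutoff (e : Plane ≃ₗᵢ[ℝ] Plane) {γ : ℝ → ℝ} (hγ : ContDiff ℝ ∞ γ) (δ : ℝ) :
    ContDiff ℝ ∞ (layerCutoff e γ δ) :=
  contDiff_ramp.comp ((contDiff_height e hγ).div_const δ)

lemma fderiv_layerCutoff_apply (e : Plane ≃ₗᵢ[ℝ] Plane) {γ : ℝ → ℝ} (hγ : ContDiff ℝ ∞ γ)
    (δ : ℝ) (x v : Plane) : fderiv ℝ (layerCutoff e γ δ) x v =
      δ⁻¹ * deriv ramp (height e γ x / δ) * fderiv ℝ (height e γ) x v := by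
  have hh : HasFDerivAt (height e γ) (fderiv ℝ (height e γ) x) x :=
    ((contDiff_height e hγ).differentiable (by simp) x).hasFDerivAt
  have hr : HasDerivAt ramp (deriv ramp (height e γ x / δ)) (height e γ x / δ) :=
    (contDiff_ramp.differentiable (by simp) _).hasDerivAt
  have hh' : HasFDerivAt (fun x => height e γ x / δ) (δ⁻¹ • fderiv ℝ (height e γ) x) x := by
    simpa [div_eq_mul_inv] using hh.mul_const δ⁻¹
  have h : HasFDerivAt (layerCutoff e γ δ) _ x := hr.comp_hasFDerivAt x hh'
  rw [h.fderiv]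
  simp
  ring

lemma layerCutoff_mem_Icc (e : Plane ≃ₗᵢ[ℝ] Plane) (γ : ℝ → ℝ) (δ : ℝ) (x : Plane) :
    layerCutoff e γ δ x ∈ Icc (0 : ℝ) 1 :=
  ⟨Real.smoothTransition.nonneg _, Real.smoothTransition.le_one _⟩

/-- `ramp` vanishes up to `1`, not merely up to `0`, so the closed support of the cutoff lies in `{δ
≤ height}`, strictly above the graph. -/
lemma tsupport_mul_layerCutoff_subset {Ω : Set Plane} {p : Plane} {r : ℝ}
    (e : Plane ≃ₗᵢ[ℝ] Plane) {γ : ℝ → ℝ} (hγ : ContDiff ℝ ∞ γ)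
    (hloc : ∀ x ∈ Metric.ball p r, x ∈ Ω ↔ γ ((e x) 0) < (e x) 1) {ψ : Plane → ℝ}
    (hsub : tsupport ψ ⊆ Metric.ball p r) {δ : ℝ} (hδ : 0 < δ) :
    tsupport (fun x => ψ x * layerCutoff e γ δ x) ⊆ Ω := by
  intro x hx
  have h1 : x ∈ tsupport ψ := tsupport_mul_subset_left hx
  have h2 : x ∈ tsupport (layerCutoff e γ δ) := tsupport_mul_subset_right hx
  have hcl : IsClosed {x | δ ≤ height e γ x} :=
    isClosed_le continuous_const (contDiff_height e hγ).continuous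
  have h3 : tsupport (layerCutoff e γ δ) ⊆ {x | δ ≤ height e γ x} := by
    refine closure_minimal (fun y hy => ?_) hcl
    by_contra h
    exact hy (ramp_of_le ((div_le_one hδ).2 (not_le.1 h).le))
  have h4 : δ ≤ height e γ x := h3 h2
  refine (hloc x (hsub h1)).2 ?_
  unfold height at h4
  linarith

/-- With `η` the cutoff, `ψ η` is supported in `Ω`, so its weak flux vanishes. By the product rule
the integral on the left is then `-∫ ψ Dη(X)`, and `|X| ≤ c` bounds it. -/
lemma enorm_setIntegral_layerCutoff_le {Ω : Set Plane} (hΩ : IsOpen Ω)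
    (hb : Bornology.IsBounded Ω) {K : ℝ}
    {X : Plane → Plane} (hX : ContinuousOn X Ω) {c : ℝ} (hXc : ∀ x ∈ Ω, ‖X x‖ ≤ c)
    (hweak : ∀ ζ : Plane → ℝ, ContDiff ℝ ∞ ζ → HasCompactSupport ζ → tsupport ζ ⊆ Ω →
      weakFlux Ω K X ζ = 0) {p : Plane} {r : ℝ}
    (e : Plane ≃ₗᵢ[ℝ] Plane) {γ : ℝ → ℝ} (hγ : ContDiff ℝ ∞ γ)
    (hloc : ∀ x ∈ Metric.ball p r, x ∈ Ω ↔ γ ((e x) 0) < (e x) 1) {ψ : Plane → ℝ}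
    (hψ : ContDiff ℝ ∞ ψ) (hc : HasCompactSupport ψ) (hψ0 : ∀ x, 0 ≤ ψ x)
    (hsub : tsupport ψ ⊆ Metric.ball p r) {δ : ℝ} (hδ : 0 < δ) :
    ‖∫ x in Ω, layerCutoff e γ δ x * (K * ψ x + fderiv ℝ ψ x (X x))‖ₑ ≤
      ENNReal.ofReal c * ∫⁻ x, ENNReal.ofReal (arcDensity γ ((e x) 0)) *
        (ENNReal.ofReal (δ⁻¹ * deriv ramp (height e γ x / δ)) * ENNReal.ofReal (ψ x)) := by
  have hη := contDiff_layerCutoff e hγ δ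
  have hA : IntegrableOn
      (fun x => layerCutoff e γ δ x * (K * ψ x + fderiv ℝ ψ x (X x))) Ω := by
    refine (integrableOn_weakFlux hΩ hb K hX hXc hψ hc).bdd_mul (c := 1)
      hη.continuous.aestronglyMeasurable (ae_of_all _ fun x => ?_)
    have := layerCutoff_mem_Icc e γ δ x
    rw [Real.norm_eq_abs, abs_of_nonneg this.1]
    exact this.2
  have hP : IntegrableOn (fun x => K * (ψ x * layerCutoff e γ δ x) +
      fderiv ℝ (fun x => ψ x * layerCutoff e γ δ x) x (X x)) Ω :=
    integrableOn_weakFlux hΩ hb K hX hXc (hψ.mul hη) hc.mul_right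
  have hsplit : ∀ x, K * (ψ x * layerCutoff e γ δ x) +
      fderiv ℝ (fun x => ψ x * layerCutoff e γ δ x) x (X x) -
      layerCutoff e γ δ x * (K * ψ x + fderiv ℝ ψ x (X x)) =
      ψ x * fderiv ℝ (layerCutoff e γ δ) x (X x) := by
    intro x
    rw [fderiv_fun_mul (hψ.differentiable (by simp) x) (hη.differentiable (by simp) x)]
    simp
    ring
  have h0 := hweak _ (hψ.mul hη) hc.mul_right
    (tsupport_mul_layerCutoff_subset e hγ hloc hsub hδ)
  have heq : ∫ x in Ω, layerCutoff e γ δ x * (K * ψ x + fderiv ℝ ψ x (X x)) =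
      - ∫ x in Ω, ψ x * fderiv ℝ (layerCutoff e γ δ) x (X x) := by
    have h1 := integral_sub hP hA
    simp only [hsplit] at h1
    rw [h1, show (∫ x in Ω, K * (ψ x * layerCutoff e γ δ x) +
      fderiv ℝ (fun x => ψ x * layerCutoff e γ δ x) x (X x)) = 0 from h0]
    ring
  rw [heq, enorm_neg, ← lintegral_const_mul' _ _ ENNReal.ofReal_ne_top]
  refine (enorm_integral_le_lintegral_enorm _).trans
    ((setLIntegral_mono' hΩ.measurableSet fun x hx => ?_).trans (setLIntegral_le_lintegral Ω _))
  have hd : 0 ≤ δ⁻¹ * deriv ramp (height e γ x / δ) :=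
    mul_nonneg (inv_nonneg.2 hδ.le) (deriv_ramp_nonneg _)
  have hc0 : 0 ≤ c := (norm_nonneg _).trans (hXc x hx)
  have hw := (arcDensity_pos γ ((e x) 0)).le
  rw [← ENNReal.ofReal_mul hd, ← ENNReal.ofReal_mul hw, ← ENNReal.ofReal_mul hc0,
    ← ofReal_norm]
  refine ENNReal.ofReal_le_ofReal ?_
  rw [fderiv_layerCutoff_apply e hγ, norm_mul, norm_mul, Real.norm_of_nonneg (hψ0 x),
    Real.norm_of_nonneg hd, Real.norm_eq_abs]
  calc ψ x * (δ⁻¹ * deriv ramp (height e γ x / δ) * |fderiv ℝ (height e γ) x (X x)|)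
      ≤ ψ x * (δ⁻¹ * deriv ramp (height e γ x / δ) * (arcDensity γ ((e x) 0) * c)) := by
        have h1 := abs_fderiv_height_le e hγ x (X x)
        have h2 := mul_le_mul_of_nonneg_left (hXc x hx) hw
        have := hψ0 x
        gcongr
        exact h1.trans h2
    _ = _ := by ring

lemma tendsto_setIntegral_layerCutoff {Ω : Set Plane} (hΩ : IsOpen Ω)
    (hb : Bornology.IsBounded Ω) {K : ℝ}
    {X : Plane → Plane} (hX : ContinuousOn X Ω) {c : ℝ} (hXc : ∀ x ∈ Ω, ‖X x‖ ≤ c)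
    {p : Plane} {r : ℝ} (e : Plane ≃ₗᵢ[ℝ] Plane) {γ : ℝ → ℝ} (hγ : ContDiff ℝ ∞ γ)
    (hloc : ∀ x ∈ Metric.ball p r, x ∈ Ω ↔ γ ((e x) 0) < (e x) 1) {ψ : Plane → ℝ}
    (hψ : ContDiff ℝ ∞ ψ) (hc : HasCompactSupport ψ)
    (hsub : tsupport ψ ⊆ Metric.ball p r) :
    Tendsto (fun n : ℕ => ∫ x in Ω, layerCutoff e γ (1 / ((n : ℝ) + 1)) x *
        (K * ψ x + fderiv ℝ ψ x (X x))) atTop (𝓝 (weakFlux Ω K X ψ)) := by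
  have hI := integrableOn_weakFlux hΩ hb K hX hXc hψ hc
  refine tendsto_integral_of_dominated_convergence
    (fun x => ‖K * ψ x + fderiv ℝ ψ x (X x)‖)
    (fun n => (contDiff_layerCutoff e hγ _).continuous.aestronglyMeasurable.mul
      hI.aestronglyMeasurable) hI.norm (fun n => ae_of_all _ fun x => ?_) ?_
  · have := layerCutoff_mem_Icc e γ (1 / ((n : ℝ) + 1)) x
    rw [norm_mul, Real.norm_of_nonneg this.1]
    exact mul_le_of_le_one_left (norm_nonneg _) this.2
  · filter_upwards [ae_restrict_mem hΩ.measurableSet] with x hx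
    by_cases hs : x ∈ tsupport ψ
    · have hpos : 0 < height e γ x := sub_pos.2 ((hloc x (hsub hs)).1 hx)
      -- The cutoff is `1` once the height is at least `2δ`, here with `δ = 1 / (n + 1)`.
      obtain ⟨N, hN⟩ := exists_nat_ge (2 / height e γ x)
      refine tendsto_const_nhds.congr' ?_
      filter_upwards [eventually_ge_atTop N] with n hn
      have : layerCutoff e γ (1 / ((n : ℝ) + 1)) x = 1 := by
        refine ramp_of_ge ?_
        have hn' : (N : ℝ) ≤ n := by exact_mod_cast hn
        rw [div_le_iff₀ hpos] at hN
        rw [div_div_eq_mul_div, div_one]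
        nlinarith
      rw [this, one_mul]
    · have h0 : ψ =ᶠ[𝓝 x] 0 := notMem_tsupport_iff_eventuallyEq.1 hs
      have h1 : fderiv ℝ ψ x = 0 := by
        rw [h0.fderiv_eq]
        exact fderiv_const_apply 0
      simp [h0.eq_of_nhds, h1]

/-- Near a boundary point, the flux of a field bounded by `c` is at most `c` times arc length, up
to a factor `1 + ε`. -/
lemma exists_nhds_weakFlux_le {Ω : Set Plane} (hΩ : IsBoundedSmoothDomain Ω) {K : ℝ}
    {X : Plane → Plane} (hX : ContinuousOn X Ω) {c : ℝ} (hXc : ∀ x ∈ Ω, ‖X x‖ ≤ c)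
    (hweak : ∀ ζ : Plane → ℝ, ContDiff ℝ ∞ ζ → HasCompactSupport ζ → tsupport ζ ⊆ Ω →
      weakFlux Ω K X ζ = 0) {ε : ℝ} (hε : 0 < ε) {p : Plane} (hp : p ∈ closure Ω) :
    ∃ U : Set Plane, IsOpen U ∧ p ∈ U ∧ ∀ ψ : Plane → ℝ, ContDiff ℝ ∞ ψ → HasCompactSupport ψ →
      (∀ x, 0 ≤ ψ x) → tsupport ψ ⊆ U →
      ‖weakFlux Ω K X ψ‖ₑ ≤ ENNReal.ofReal c * (ENNReal.ofReal (1 + ε) *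
        ∫⁻ x in frontier Ω, ENNReal.ofReal (ψ x) ∂(Measure.hausdorffMeasure 1)) := by
  by_cases hpΩ : p ∈ Ω
  · exact ⟨Ω, hΩ.isOpen, hpΩ, fun ψ h1 h2 _ h3 => by simp [hweak ψ h1 h2 h3]⟩
  have hpf : p ∈ frontier Ω := by rw [hΩ.isOpen.frontier_eq]; exact ⟨hp, hpΩ⟩
  obtain ⟨r, hr, e, γ, hγ, hloc⟩ := hΩ.smooth_boundary p hpf
  obtain ⟨ρ, hρ, hlen⟩ := exists_nhds_lintegral_arcDensity_le e hγ ((e p) 0) hε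
  have h0 := (contDiff_coord e 0).continuous
  refine ⟨Metric.ball p r ∩ (fun x => (e x) 0) ⁻¹' Metric.ball ((e p) 0) ρ,
    Metric.isOpen_ball.inter (Metric.isOpen_ball.preimage h0),
    ⟨Metric.mem_ball_self hr, Metric.mem_ball_self hρ⟩, fun ψ hψ hc hψ0 hsub => ?_⟩
  have hsub' : tsupport ψ ⊆ Metric.ball p r := hsub.trans inter_subset_left
  have hlim := (continuous_enorm.tendsto _).comp
    (tendsto_setIntegral_layerCutoff hΩ.isOpen hΩ.isBounded (K := K) hX hXc e hγ hloc hψ hc hsub')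
  have hlim' := ENNReal.Tendsto.const_mul (a := ENNReal.ofReal c)
    (tendsto_lintegral_layer e hγ hψ.continuous hc tendsto_one_div_add_atTop_nhds_zero_nat)
    (Or.inr ENNReal.ofReal_ne_top)
  refine (le_of_tendsto_of_tendsto' hlim hlim' fun n => ?_).trans ?_
  · have hδ : (0 : ℝ) < 1 / ((n : ℝ) + 1) := by positivity
    rw [← lintegral_scaled_layer e hγ hψ.continuous hδ]
    exact enorm_setIntegral_layerCutoff_le hΩ.isOpen hΩ.isBounded hX hXc hweak e hγ hloc hψ hc
      hψ0 hsub' hδ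
  · gcongr
    refine lintegral_arcDensity_le e hγ.continuous measurableSet_ball hlen
      hψ.continuous.measurable.ennreal_ofReal isClosed_frontier.measurableSet fun s hs => ?_
    have hne : ψ (graphPoint e γ 0 s) ≠ 0 := fun h => hs (by simp [h])
    obtain ⟨h1, h2⟩ := hsub (subset_tsupport _ hne)
    exact ⟨by simpa using h2, graphPoint_mem_frontier hΩ.isOpen e hγ.continuous hloc h1⟩

/-! ### From local to global -/

lemma height_eq_zero_of_mem_frontier {Ω : Set Plane} (hΩ : IsOpen Ω) {p : Plane} {r : ℝ}
    (e : Plane ≃ₗᵢ[ℝ] Plane) {γ : ℝ → ℝ} (hγ : ContDiff ℝ ∞ γ)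
    (hloc : ∀ x ∈ Metric.ball p r, x ∈ Ω ↔ γ ((e x) 0) < (e x) 1) {x : Plane}
    (hx : x ∈ Metric.ball p r) (hf : x ∈ frontier Ω) : height e γ x = 0 := by
  rw [hΩ.frontier_eq] at hf
  have h1 : ¬ 0 < height e γ x := fun h => hf.2 ((hloc x hx).2 (sub_pos.1 h))
  refine le_antisymm (not_lt.1 h1) (not_lt.1 fun h2 => ?_)
  have hopen : IsOpen (Metric.ball p r ∩ {y | height e γ y < 0}) :=
    Metric.isOpen_ball.inter
      (isOpen_lt (contDiff_height e hγ).continuous continuous_const)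
  obtain ⟨y, ⟨hy1, hy2⟩, hy3⟩ := mem_closure_iff.1 hf.1 _ hopen ⟨hx, h2⟩
  exact (sub_pos.2 ((hloc y hy1).1 hy3)).not_gt hy2

lemma graphPoint_coord (e : Plane ≃ₗᵢ[ℝ] Plane) {γ : ℝ → ℝ} {x : Plane}
    (h : height e γ x = 0) : graphPoint e γ 0 ((e x) 0) = x := by
  apply e.injective
  rw [apply_graphPoint]
  ext i
  unfold height at h
  fin_cases i
  · simp
  · simp; linarith

/-- Locally the boundary lies in a Lipschitz image of an interval, and it is compact. Finiteness
matters because `length` would turn an infinite measure into `0`. -/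
lemma hausdorffMeasure_frontier_lt_top {Ω : Set Plane} (hΩ : IsBoundedSmoothDomain Ω) :
    Measure.hausdorffMeasure 1 (frontier Ω) < (⊤ : ℝ≥0∞) := by
  have hK : IsCompact (frontier Ω) :=
    hΩ.isBounded.isCompact_closure.of_isClosed_subset isClosed_frontier frontier_subset_closure
  refine hK.measure_lt_top_of_nhdsWithin fun p hp => ?_
  obtain ⟨r, hr, e, γ, hγ, hloc⟩ := hΩ.smooth_boundary p hp
  have hG : ContDiff ℝ 1 (graphPoint e γ 0) := by
    refine e.symm.contDiff.comp (contDiff_euclidean.2 fun i => ?_)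
    fin_cases i
    · exact contDiff_id
    · exact (hγ.of_le (by simp)).add contDiff_const
  obtain ⟨k, t, ht, hlip⟩ := hG.locallyLipschitz ((e p) 0)
  obtain ⟨ρ, hρ, hρt⟩ := Metric.mem_nhds_iff.1 ht
  refine ⟨frontier Ω ∩ Metric.ball p (min r ρ),
    inter_mem_nhdsWithin _ (Metric.ball_mem_nhds p (lt_min hr hρ)), ?_⟩
  have hsub : frontier Ω ∩ Metric.ball p (min r ρ) ⊆
      graphPoint e γ 0 '' Metric.ball ((e p) 0) ρ := by
    rintro x ⟨hxf, hx⟩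
    have h0 := height_eq_zero_of_mem_frontier hΩ.isOpen e hγ hloc
      (Metric.ball_subset_ball (min_le_left _ _) hx) hxf
    refine ⟨(e x) 0, ?_, graphPoint_coord e h0⟩
    rw [Metric.mem_ball, Real.dist_eq]
    have h1 := PiLp.norm_apply_le (e x - e p) 0
    rw [← map_sub, e.norm_map, ← dist_eq_norm, map_sub] at h1
    exact (show |(e x) 0 - (e p) 0| ≤ dist x p from h1).trans_lt
      ((Metric.mem_ball.1 hx).trans_le (min_le_right _ _))
  refine (measure_mono hsub).trans_lt
    (((hlip.mono hρt).hausdorffMeasure_image_le zero_le_one).trans_lt ?_)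
  rw [hausdorffMeasure_real, Real.volume_ball]
  simp [ENNReal.mul_lt_top_iff]

lemma enorm_integral_const_le {Ω : Set Plane} (hΩ : IsBoundedSmoothDomain Ω) {K : ℝ}
    {X : Plane → Plane} (hX : ContinuousOn X Ω) {c : ℝ} (hXc : ∀ x ∈ Ω, ‖X x‖ ≤ c)
    (hweak : ∀ ζ : Plane → ℝ, ContDiff ℝ ∞ ζ → HasCompactSupport ζ → tsupport ζ ⊆ Ω →
      weakFlux Ω K X ζ = 0) {ε : ℝ} (hε : 0 < ε) :
    ‖∫ _ in Ω, K‖ₑ ≤ ENNReal.ofReal c * (ENNReal.ofReal (1 + ε) *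
        Measure.hausdorffMeasure 1 (frontier Ω)) := by
  choose! U hUo hpU hU using fun p (hp : p ∈ closure Ω) =>
    exists_nhds_weakFlux_le hΩ hX hXc hweak hε hp
  obtain ⟨t, htΩ, ht⟩ := hΩ.isBounded.isCompact_closure.elim_nhds_subcover
    -- The unit ball only serves to make the partition functions compactly supported.
    (fun p => U p ∩ Metric.ball p 1)
    fun p hp => ((hUo p hp).inter Metric.isOpen_ball).mem_nhds
      ⟨hpU p hp, Metric.mem_ball_self one_pos⟩
  obtain ⟨f, hf⟩ := SmoothPartitionOfUnity.exists_isSubordinate 𝓘(ℝ, Plane)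
    (isClosed_closure (s := Ω)) (fun p : t => U p ∩ Metric.ball (p : Plane) 1)
    (fun p => (hUo p (htΩ p p.2)).inter Metric.isOpen_ball)
    (fun x hx => by simpa using ht hx)
  have hsmooth : ∀ p, ContDiff ℝ ∞ (f p) := fun p => contMDiff_iff_contDiff.1 (f p).contMDiff
  have hcs : ∀ p, HasCompactSupport (f p) := fun p =>
    Metric.isCompact_of_isClosed_isBounded (isClosed_tsupport _)
      (Metric.isBounded_ball.subset ((hf p).trans inter_subset_right))
  have hsum : ∀ x ∈ closure Ω, ∑ p, f p x = 1 := fun x hx => by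
    rw [← finsum_eq_sum_of_fintype]
    exact f.sum_eq_one hx
  have hflux : ∫ _ in Ω, K = ∑ p, weakFlux Ω K X (f p) := by
    unfold weakFlux
    rw [← integral_finsetSum _ fun p _ =>
      integrableOn_weakFlux hΩ.isOpen hΩ.isBounded K hX hXc (hsmooth p) (hcs p)]
    refine setIntegral_congr_fun hΩ.isOpen.measurableSet fun x hx => ?_
    -- The sum is constant near `x`, so the derivative terms of the fluxes cancel.
    have h1 : (fun y => ∑ p, f p y) =ᶠ[𝓝 x] fun _ => 1 := by
      filter_upwards [hΩ.isOpen.mem_nhds hx] with y hy using hsum y (subset_closure hy)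
    have h2 : ∑ p, fderiv ℝ (f p) x = 0 := by
      rw [← fderiv_fun_sum fun p _ => (hsmooth p).differentiable (by simp) x, h1.fderiv_eq]
      exact fderiv_const_apply _
    have h3 := congrArg (fun l : Plane →L[ℝ] ℝ => l (X x)) h2
    simp only [_root_.sum_apply, _root_.zero_apply] at h3
    simp only [Finset.sum_add_distrib, ← Finset.mul_sum, h3, hsum x (subset_closure hx)]
    ring
  calc ‖∫ _ in Ω, K‖ₑ ≤ ∑ p, ‖weakFlux Ω K X (f p)‖ₑ := by
        rw [hflux]; exact enorm_sum_le _ _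
    _ ≤ ∑ p, ENNReal.ofReal c * (ENNReal.ofReal (1 + ε) *
        ∫⁻ x in frontier Ω, ENNReal.ofReal (f p x) ∂(Measure.hausdorffMeasure 1)) :=
        Finset.sum_le_sum fun p _ => hU p (htΩ p p.2) _ (hsmooth p) (hcs p) (f.nonneg p)
          ((hf p).trans inter_subset_left)
    _ = _ := by
        rw [← Finset.mul_sum, ← Finset.mul_sum, ← lintegral_finsetSum _ fun p _ =>
          (hsmooth p).continuous.measurable.ennreal_ofReal]
        congr 2
        rw [← setLIntegral_one]
        refine setLIntegral_congr_fun isClosed_frontier.measurableSet fun x hx => ?_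
        rw [← ENNReal.ofReal_sum_of_nonneg fun p _ => f.nonneg p x,
          hsum x (frontier_subset_closure hx), ENNReal.ofReal_one]

/-- If a vector field bounded by `c` has constant divergence `K`, then
`|K| area Ω ≤ c length ∂Ω`. -/
lemma abs_mul_area_le {Ω : Set Plane} (hΩ : IsBoundedSmoothDomain Ω) {K : ℝ}
    {X : Plane → Plane} (hX : ContDiffOn ℝ 1 X Ω) {c : ℝ} (hXc : ∀ x ∈ Ω, ‖X x‖ ≤ c)
    (hdiv : ∀ x ∈ Ω, ∑ i, partialD i (fun y => X y i) x = K) :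
    |K| * area Ω ≤ c * length (frontier Ω) := by
  have hc : 0 ≤ c := by
    obtain ⟨x, hx⟩ := hΩ.isConnected.nonempty
    exact (norm_nonneg _).trans (hXc x hx)
  have hweak : ∀ ζ : Plane → ℝ, ContDiff ℝ ∞ ζ → HasCompactSupport ζ → tsupport ζ ⊆ Ω →
      weakFlux Ω K X ζ = 0 := fun ζ =>
    weakFlux_eq_zero hΩ.isOpen (contDiffOn_euclidean.1 hX) hdiv
  have hlim : Tendsto (fun ε : ℝ => c * ((1 + ε) * length (frontier Ω))) (𝓝[>] 0)
      (𝓝 (c * length (frontier Ω))) := by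
    have : Continuous fun ε : ℝ => c * ((1 + ε) * length (frontier Ω)) := by fun_prop
    simpa using (this.tendsto 0).mono_left nhdsWithin_le_nhds
  refine ge_of_tendsto hlim ?_
  filter_upwards [self_mem_nhdsWithin] with ε hε
  have hε' : (0 : ℝ) < ε := hε
  have h := enorm_integral_const_le hΩ hX.continuousOn hXc hweak hε'
  have h' := ENNReal.toReal_mono (ENNReal.mul_ne_top ENNReal.ofReal_ne_top
    (ENNReal.mul_ne_top ENNReal.ofReal_ne_top (hausdorffMeasure_frontier_lt_top hΩ).ne)) h
  rw [ENNReal.toReal_mul, ENNReal.toReal_mul, ENNReal.toReal_ofReal hc,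
    ENNReal.toReal_ofReal (by linarith), toReal_enorm, setIntegral_const, norm_smul,
    Real.norm_of_nonneg measureReal_nonneg, mul_comm] at h'
  exact h'

lemma area_pos {Ω : Set Plane} (hΩ : IsBoundedSmoothDomain Ω) : 0 < area Ω :=
  ENNReal.toReal_pos (hΩ.isOpen.measure_pos volume hΩ.isConnected.nonempty).ne'
    hΩ.isBounded.measure_lt_top.ne

/-- The flux bound for the position field, which is bounded on `Ω` and has divergence `2`, would
force the area to vanish if the length did. -/
lemma length_frontier_pos {Ω : Set Plane} (hΩ : IsBoundedSmoothDomain Ω) :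
    0 < length (frontier Ω) := by
  obtain ⟨R, hR⟩ := hΩ.isBounded.exists_norm_le
  have h := abs_mul_area_le hΩ (K := 2) (X := id) contDiffOn_id hR fun x _ => by
    have : ∀ i : Fin 2, partialD i (fun y : Plane => y i) x = 1 := fun i => by
      have hd : HasFDerivAt (fun y : Plane => y i) (EuclideanSpace.proj i : Plane →L[ℝ] ℝ) x :=
        ContinuousLinearMap.hasFDerivAt (EuclideanSpace.proj i : Plane →L[ℝ] ℝ)
      rw [partialD, hd.fderiv]
      simp
    simp [this]
  have hpos : 0 < |(2 : ℝ)| * area Ω := mul_pos (by norm_num) (area_pos hΩ)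
  have hL : 0 ≤ length (frontier Ω) := ENNReal.toReal_nonneg
  refine hL.lt_of_ne fun h0 => ?_
  rw [← h0, mul_zero] at h
  linarith

/-! ### The mean curvature equation in divergence form -/

/-- The horizontal part `Du / √(1 + |Du|²)` of the unit normal of the graph of `u`. -/
noncomputable def normalField (u : Plane → ℝ) (x : Plane) : Plane :=
  WithLp.toLp 2 fun i => partialD i u x / √(1 + gradSq u x)

lemma gradSq_nonneg (u : Plane → ℝ) (x : Plane) : 0 ≤ gradSq u x :=
  Finset.sum_nonneg fun _ _ => sq_nonneg _

lemma norm_normalField (u : Plane → ℝ) (x : Plane) :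
    ‖normalField u x‖ = √(gradSq u x / (1 + gradSq u x)) := by
  have h := gradSq_nonneg u x
  rw [EuclideanSpace.norm_eq]
  congr 1
  simp only [normalField, Real.norm_eq_abs, sq_abs, div_pow, Real.sq_sqrt (by linarith :
    0 ≤ 1 + gradSq u x), ← Finset.sum_div]
  rfl

lemma contDiffOn_partialD {Ω : Set Plane} (hΩ : IsOpen Ω) {u : Plane → ℝ}
    (hu : ContDiffOn ℝ 2 u Ω) (i : Fin 2) : ContDiffOn ℝ 1 (partialD i u) Ω :=
  (hu.fderiv_of_isOpen hΩ (by norm_num)).clm_apply contDiffOn_const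

lemma contDiffOn_normalField {Ω : Set Plane} (hΩ : IsOpen Ω) {u : Plane → ℝ}
    (hu : ContDiffOn ℝ 2 u Ω) : ContDiffOn ℝ 1 (normalField u) Ω := by
  have hP := contDiffOn_partialD hΩ hu
  have hW : ∀ x, 0 < 1 + gradSq u x := fun x => by linarith [gradSq_nonneg u x]
  refine contDiffOn_euclidean.2 fun i => (hP i).div (ContDiffOn.sqrt ?_ fun x _ => (hW x).ne')
    fun x _ => (Real.sqrt_pos.2 (hW x)).ne'
  exact contDiffOn_const.add (ContDiffOn.sum fun j _ => (hP j).pow 2)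

lemma hasDerivAt_line {f : Plane → ℝ} {x : Plane} (hf : DifferentiableAt ℝ f x) (i : Fin 2) :
    HasDerivAt (fun t : ℝ => f (x + t • EuclideanSpace.single i (1 : ℝ))) (partialD i f x) 0 :=
  hf.hasFDerivAt.hasLineDerivAt _

/-- By the quotient rule, `W³` times the divergence, with `W = √(1 + |Du|²)`, is the left side of
the equation. -/
lemma sum_partialD_normalField {Ω : Set Plane} (hΩ : IsOpen Ω) {H : ℝ} {φ u : Plane → ℝ}
    (hu : IsDirichletSolution Ω H φ u) {x : Plane} (hx : x ∈ Ω) :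
    ∑ i, partialD i (fun y => normalField u y i) x = 2 * H := by
  have hP : ∀ j, DifferentiableAt ℝ (partialD j u) x := fun j =>
    ((contDiffOn_partialD hΩ hu.contDiffOn j).contDiffAt (hΩ.mem_nhds hx)).differentiableAt
      (by simp)
  have hN : ∀ i, DifferentiableAt ℝ (fun y => normalField u y i) x := fun i =>
    (((contDiffOn_euclidean.1 (contDiffOn_normalField hΩ hu.contDiffOn)) i).contDiffAt
      (hΩ.mem_nhds hx)).differentiableAt (by simp)
  have hpos : 0 < 1 + gradSq u x := by linarith [gradSq_nonneg u x]
  set W := √(1 + gradSq u x) with hWdef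
  have hW : 0 < W := Real.sqrt_pos.2 hpos
  have hW2 : W ^ 2 = 1 + gradSq u x := Real.sq_sqrt hpos.le
  have hW3 : (1 + gradSq u x) ^ (3 / 2 : ℝ) = W ^ 3 := by
    rw [hWdef, Real.sqrt_eq_rpow, ← Real.rpow_natCast, ← Real.rpow_mul hpos.le]
    norm_num
  have hpart : ∀ i, partialD i (fun y => normalField u y i) x =
      (partialD i (partialD i u) x * W - partialD i u x *
        ((∑ j, 2 * partialD j u x * partialD i (partialD j u) x) / (2 * W))) / W ^ 2 := by
    intro i
    have hg : HasDerivAt (fun t : ℝ => 1 + gradSq u (x + t • EuclideanSpace.single i (1 : ℝ)))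
        (∑ j, 2 * partialD j u x * partialD i (partialD j u) x) 0 := by
      refine HasDerivAt.const_add 1 (HasDerivAt.fun_sum fun j _ => ?_)
      simpa using (hasDerivAt_line (hP j) i).fun_pow 2
    have hs := hg.sqrt (by simpa using hpos.ne')
    have hd := (hasDerivAt_line (hP i) i).fun_div hs (by simpa using hW.ne')
    have := (hasDerivAt_line (hN i) i).unique hd
    simpa using this
  have heq := hu.equation x hx
  rw [hW3, ← hW2] at heq
  simp only [hpart]
  simp only [lap, Fin.sum_univ_two] at heq ⊢
  field_simp
  linarith

lemma exists_gradSq_le {Ω : Set Plane} (hb : Bornology.IsBounded Ω) {u : Plane → ℝ}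
    (hu : GradExtends Ω u) : ∃ B, ∀ x ∈ Ω, gradSq u x ≤ B := by
  choose g hg hgu using hu
  have hcont : ContinuousOn (fun x => ∑ i, g i x ^ 2) (closure Ω) := by fun_prop
  obtain ⟨B, hB⟩ := (hb.isCompact_closure.bddAbove_image hcont)
  refine ⟨B, fun x hx => ?_⟩
  have := hB (mem_image_of_mem _ (subset_closure hx))
  simpa [gradSq, hgu _ x hx] using this

lemma abs_le_mul_length_div_area {Ω : Set Plane} (hΩ : IsBoundedSmoothDomain Ω) {H : ℝ}
    {φ u : Plane → ℝ} (hu : IsDirichletSolution Ω H φ u) {c : ℝ}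
    (hc : ∀ x ∈ Ω, ‖normalField u x‖ ≤ c) :
    |H| ≤ c * length (frontier Ω) / (2 * area Ω) := by
  have h := abs_mul_area_le hΩ (contDiffOn_normalField hΩ.isOpen hu.contDiffOn) hc
    fun x hx => sum_partialD_normalField hΩ.isOpen hu hx
  have hA := area_pos hΩ
  rw [le_div_iff₀ (by linarith)]
  rw [abs_mul, abs_two] at h
  linarith

end CMC

theorem mainTheorem11 (Ω : Set CMC.Plane) (hΩ : CMC.IsBoundedSmoothDomain Ω) (H : ℝ)
    (φ : CMC.Plane → ℝ) (hφ : ContinuousOn φ (frontier Ω)) :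
    ((∃ u : CMC.Plane → ℝ, CMC.IsDirichletSolution Ω H φ u ∧ CMC.GradExtends Ω u) →
      |H| < CMC.length (frontier Ω) / (2 * CMC.area Ω)) ∧
    ((∃ u : CMC.Plane → ℝ, CMC.IsDirichletSolution Ω H φ u) →
      |H| ≤ CMC.length (frontier Ω) / (2 * CMC.area Ω)) := by
  constructor
  · rintro ⟨u, hu, hext⟩
    obtain ⟨B, hB⟩ := CMC.exists_gradSq_le hΩ.isBounded hext
    obtain ⟨x₀, hx₀⟩ := hΩ.isConnected.nonempty
    have hB0 : 0 ≤ B := (CMC.gradSq_nonneg u x₀).trans (hB x₀ hx₀)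
    -- `t / (1 + t)` increases with `t`, so the gradient bound `B` keeps `|X|` uniformly below `1`.
    have hle := CMC.abs_le_mul_length_div_area hΩ hu (c := √(B / (1 + B))) fun x hx => by
      rw [CMC.norm_normalField]
      refine Real.sqrt_le_sqrt ?_
      have h0 := CMC.gradSq_nonneg u x
      have h1 := hB x hx
      rw [div_le_div_iff₀ (by linarith) (by linarith)]
      linarith
    refine hle.trans_lt ?_
    have hlt : √(B / (1 + B)) < 1 := by
      rw [Real.sqrt_lt' one_pos, one_pow, div_lt_one (by linarith)]
      linarith
    have hA := CMC.area_pos hΩ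
    have hL := CMC.length_frontier_pos hΩ
    exact div_lt_div_of_pos_right (mul_lt_of_lt_one_left hL hlt) (by linarith)
  · rintro ⟨u, hu⟩
    simpa using CMC.abs_le_mul_length_div_area hΩ hu (c := 1) fun x _ => by
      have h0 := CMC.gradSq_nonneg u x
      rw [CMC.norm_normalField, Real.sqrt_le_iff, one_pow, div_le_one (by linarith)]
      exact ⟨zero_le_one, by linarith⟩
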